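/- Let $C,r,N$ be integers with $1\le r<C$ and $N\ge 1$, and let $\mathbb F_q$ be a finite field. In the $(C,r,M,N)$ combinatorial multi-access network a server holds $N$ independent files $W_1,\dots,W_N$, each uniformly distributed on $\mathbb F_q^f$ ($f$ symbols make up one unit, i.e. one file). There are $C$ caches, and exactly one user for each $r$-element subset $\mathcal U\subset\{1,\dots,C\}$, who reads the caches in $\mathcal U$. A scheme with file length $f\ge1$ consists of cache contents $Z_1,\dots,Z_C$, where each $Z_c$ is an arbitrary function of the files taking values in $\mathbb F_q^{m_c}$ for some integer $m_c\ge 0$ and not depending on the demands, and, for each demand vector $\mathbf d=(d_{\mathcal U})_{\mathcal U}$ with $d_{\mathcal U}\in\{1,\dots,N\}$, of a transmission $X_{\mathbf d}$, an arbitrary function of the files taking values in $\mathbb F_q^{k_{\mathbf d}}$ for some integer $k_{\mathbf d}\ge 0$. A rate $R$ is achievable with cache memory $M$ if for some $f\ge 1$ there is such a scheme with $m_c\le Mf$ for every cache $c$, $k_{\mathbf d}\le Rf$ for every $\mathbf d$, and $H(W_{d_{\mathcal U}}\mid (Z_c)_{c\in\mathcal U},X_{\mathbf d})=0$ for every $\mathbf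 d$ and every user $\mathcal U$. Let $R^*(M)=\inf\{R: R\text{ is achievable with cache memory }M\}$. Then, for every real $M$ with $$\frac{\binom{C}{r}-1}{r\binom{C}{r}}\le \frac MN\le \frac1r,$$ one has $$R^*(M)=1-\frac{rM}{N}.$$ -/

import Mathlib

namespace MACC

/-- Probability of an event under the uniform distribution on a finite sample space. -/
noncomputable def prob {Ω : Type*} [Fintype Ω] (E : Set Ω) : ℝ :=
  (E.ncard : ℝ) / (Fintype.card Ω : ℝ)

/-- Conditional Shannon entropy `H(X | Y)` (in nats) of two random variables on a finite sample
space with the uniform distribution: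
`∑ y, P(Y = y) * H(X | Y = y)`, where `H(X | Y = y)` is the entropy of the conditional law. -/
noncomputable def condEntropy {Ω α β : Type*} [Fintype Ω] [Fintype α] [Fintype β]
    (X : Ω → α) (Y : Ω → β) : ℝ :=
  ∑ y, prob {w | Y w = y} *
    ∑ x, Real.negMulLog (prob {w | X w = x ∧ Y w = y} / prob {w | Y w = y})

/-- The library: `N` files, each made of `f` symbols of the alphabet `F`. The uniform distribution
on this type makes the files independent and uniformly distributed. -/
abbrev Library (F : Type*) (N f : ℕ) : Type _ := Fin N → Fin f → F

/-- A user is a set of `r` of the `C` caches, namely those it accesses. -/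
abbrev User (C r : ℕ) : Type := {U : Finset (Fin C) // U.card = r}

/-- A demand vector: the index of the file requested by each user. -/
abbrev Demand (C r N : ℕ) : Type := User C r → Fin N

/-- Placement and delivery for `C` caches, one user for each `r` caches, and `N` files of `f`
symbols. The placement is arbitrary (coded or uncoded) and does not depend on the demand; the
transmission depends on the demand vector and the library. Lengths are counted in symbols. -/
structure Scheme (F : Type*) (C r N f : ℕ) where
  /-- number of symbols stored in each cache -/
  cacheLen : Fin C → ℕ
  /-- the content of each cache, a function of the library -/
  cache : (c : Fin C) → Library F N f → (Fin (cacheLen c) → F)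
  /-- number of symbols sent for each demand vector -/
  sendLen : Demand C r N → ℕ
  /-- the transmission for each demand vector, a function of the library -/
  send : (d : Demand C r N) → Library F N f → (Fin (sendLen d) → F)

namespace Scheme

variable {F : Type*} {C r N f : ℕ}

/-- What user `U` observes when the demand vector is `d`: the contents of its caches and the
transmission. -/
def observation (S : Scheme F C r N f) (d : Demand C r N) (U : User C r) (W : Library F N f) :
    ((c : {c // c ∈ U.1}) → (Fin (S.cacheLen c.1) → F)) × (Fin (S.sendLen d) → F) :=
  (fun c => S.cache c.1 W, S.send d W)

/-- For every demand vector, each user decodes its file: `H(W_{d_U} | Z_U, X) = 0`. -/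
def Decodable [Fintype F] (S : Scheme F C r N f) : Prop :=
  ∀ (d : Demand C r N) (U : User C r),
    condEntropy (fun W : Library F N f => W (d U)) (S.observation d U) = 0

end Scheme

/-- The rates `R` achievable with cache memory `M`; both are measured in files, that is, in units
of `f` symbols. -/
def achievableRates (F : Type*) [Fintype F] (C r N : ℕ) (M : ℝ) : Set ℝ :=
  {R : ℝ | ∃ f : ℕ, 0 < f ∧ ∃ S : Scheme F C r N f,
    (∀ c, (S.cacheLen c : ℝ) ≤ M * f) ∧ (∀ d, (S.sendLen d : ℝ) ≤ R * f) ∧ S.Decodable}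

/-- The optimal rate-memory trade-off `R*(M)`. -/
noncomputable def optimalRate (F : Type*) [Fintype F] (C r N : ℕ) (M : ℝ) : ℝ :=
  sInf (achievableRates F C r N M)

end MACC

/-! The lower bound is a cut-set argument (`Scheme.cutset_bound`): the caches of one user and the
transmissions for the `N` constant demands determine the library.

For achievability, write `K = C.choose r`. It suffices to reach every rational rate `q = a / (K * a
+ b)` with `N * (1 - q) ≤ r * M`; here `b ≥ 0` amounts to `q ≤ 1 / K`, which is the lower end of the
memory range. In each file some pieces are labelled by a user `U`, and the caches of `U` store
generic linear combinations omitting them. User `U` then has as many equations as there are other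
pieces, and solves for these in every file. A sum over all users of one requested piece each,
carrying that user's label, gives `U` its missing piece, because `U` knows every other term.

Generic solvability needs a perfect matching of equations with pieces. Labelling the pieces by
orders of the caches as well yields one by symmetry (`Piece.exists_matching`), and a finite
extension of `F` supplies the coefficients (`exists_placement_coefficients`). -/

namespace MACC

/-! ### Zero conditional entropy as functional dependence -/

section Entropy

variable {Ω α β : Type*} [Fintype Ω]

lemma prob_nonneg (E : Set Ω) : 0 ≤ prob E := by
  unfold prob; positivity

lemma prob_mono {E G : Set Ω} (h : E ⊆ G) : prob E ≤ prob G := by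
  unfold prob
  gcongr
  exact G.toFinite

lemma prob_pos {E : Set Ω} (h : E.Nonempty) : 0 < prob E := by
  obtain ⟨w, hw⟩ := h
  have : Nonempty Ω := ⟨w⟩
  have h1 : 0 < E.ncard := (Set.ncard_pos E.toFinite).2 ⟨w, hw⟩
  have h2 : 0 < Fintype.card Ω := Fintype.card_pos
  unfold prob; positivity

lemma eq_of_subset_of_prob_eq {E G : Set Ω} (h : E ⊆ G) (hp : prob E = prob G) : E = G := by
  rcases isEmpty_or_nonempty Ω with hΩ | hΩ
  · exact Subsingleton.elim _ _
  have h2 : (0 : ℝ) < Fintype.card Ω := by exact_mod_cast Fintype.card_pos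
  unfold prob at hp
  have h3 : (E.ncard : ℝ) = G.ncard := by field_simp at hp; exact hp
  exact Set.eq_of_subset_of_ncard_le h (by exact_mod_cast h3.ge) G.toFinite

lemma condEntropy_eq_zero_iff [Fintype α] [Fintype β] (X : Ω → α) (Y : Ω → β) :
    condEntropy X Y = 0 ↔ ∀ w w', Y w = Y w' → X w = X w' := by
  have hratio (x : α) (y : β) :
      0 ≤ prob {w | X w = x ∧ Y w = y} / prob {w | Y w = y} ∧
      prob {w | X w = x ∧ Y w = y} / prob {w | Y w = y} ≤ 1 :=
    ⟨div_nonneg (prob_nonneg _) (prob_nonneg _),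
      div_le_one_of_le₀ (prob_mono fun w hw => hw.2) (prob_nonneg _)⟩
  constructor
  · intro h w w' hY
    have h0 : ∀ y ∈ Finset.univ, 0 ≤ prob {w | Y w = y} *
        ∑ x, Real.negMulLog (prob {w | X w = x ∧ Y w = y} / prob {w | Y w = y}) := fun y _ =>
      mul_nonneg (prob_nonneg _) (Finset.sum_nonneg fun x _ =>
        Real.negMulLog_nonneg (hratio x y).1 (hratio x y).2)
    have h1 := (Finset.sum_eq_zero_iff_of_nonneg h0).1 h (Y w) (Finset.mem_univ _)
    have hpos : 0 < prob {v | Y v = Y w} := prob_pos ⟨w, rfl⟩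
    have h2 := (mul_eq_zero.1 h1).resolve_left hpos.ne'
    have h3 := (Finset.sum_eq_zero_iff_of_nonneg fun x _ =>
      Real.negMulLog_nonneg (hratio x (Y w)).1 (hratio x (Y w)).2).1 h2 (X w) (Finset.mem_univ _)
    have hpos' : 0 < prob {v | X v = X w ∧ Y v = Y w} := prob_pos ⟨w, rfl, rfl⟩
    have h4 : prob {v | X v = X w ∧ Y v = Y w} / prob {v | Y v = Y w} = 1 := by
      have hq := div_pos hpos' hpos
      rw [Real.negMulLog, neg_mul, neg_eq_zero, mul_eq_zero, Real.log_eq_zero] at h3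
      -- The zeros of `x * log x` are 0, 1 and -1; positivity of the ratio leaves 1.
      rcases h3 with h3 | h3 | h3 | h3 <;> linarith
    have h5 := eq_of_subset_of_prob_eq (E := {v | X v = X w ∧ Y v = Y w})
      (G := {v | Y v = Y w}) (fun v hv => hv.2) ((div_eq_one_iff_eq hpos.ne').1 h4)
    have h6 : w' ∈ {v | X v = X w ∧ Y v = Y w} := by rw [h5]; exact hY.symm
    exact h6.1.symm
  · intro h
    refine Finset.sum_eq_zero fun y _ => ?_
    refine mul_eq_zero_of_right _ (Finset.sum_eq_zero fun x _ => ?_)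
    rcases Set.eq_empty_or_nonempty {w | X w = x ∧ Y w = y} with he | ⟨w, hx, hy⟩
    · simp [he, prob]
    · have : {w | X w = x ∧ Y w = y} = {w | Y w = y} := by
        ext v
        refine ⟨fun hv => hv.2, fun hv => ⟨?_, hv⟩⟩
        rw [← hx]
        exact h v w (hv.trans hy.symm)
      rw [this, div_self (prob_pos ⟨w, hy⟩).ne', Real.negMulLog_one]

end Entropy

/-! ### Decodability and the cut-set bound -/

lemma Scheme.decodable_iff {F : Type*} [Fintype F] {C r N f : ℕ} (S : Scheme F C r N f) :
    S.Decodable ↔ ∀ (d : Demand C r N) (U : User C r) (W W' : Library F N f),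
      (∀ c ∈ U.1, S.cache c W = S.cache c W') → S.send d W = S.send d W' →
        W (d U) = W' (d U) := by
  unfold Scheme.Decodable
  refine forall₂_congr fun d U => ?_
  rw [condEntropy_eq_zero_iff]
  refine forall₂_congr fun W W' => ?_
  constructor
  · intro h h1 h2
    exact h (Prod.ext (funext fun c => h1 c.1 c.2) h2)
  · intro h h1
    exact h (fun c hc => congrFun (congrArg Prod.fst h1) ⟨c, hc⟩) (congrArg Prod.snd h1)

/-- The cut-set bound for one user and the `N` constant demand vectors. -/
lemma Scheme.cutset_bound {F : Type*} [Fintype F] [Nontrivial F] {C r N f : ℕ}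
    (S : Scheme F C r N f) (hS : S.Decodable) (U : User C r) :
    N * f ≤ ∑ c ∈ U.1, S.cacheLen c + ∑ n : Fin N, S.sendLen (fun _ => n) := by
  classical
  rw [Scheme.decodable_iff] at hS
  let g : Library F N f → ((c : {c // c ∈ U.1}) → (Fin (S.cacheLen c.1) → F)) ×
      ((n : Fin N) → (Fin (S.sendLen (fun _ => n)) → F)) :=
    fun W => (fun c => S.cache c.1 W, fun n => S.send (fun _ => n) W)
  have hg : Function.Injective g := by
    intro W W' h
    funext n
    exact hS (fun _ => n) U W W'
      (fun c hc => congrFun (congrArg Prod.fst h) ⟨c, hc⟩) (congrFun (congrArg Prod.snd h) n)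
  have hcard := Fintype.card_le_of_injective g hg
  simp only [Fintype.card_pi, Fintype.card_prod, Finset.prod_const, Finset.card_univ,
    Fintype.card_fin, Finset.prod_pow_eq_pow_sum, ← pow_add, ← pow_mul] at hcard
  have h1 := (Nat.pow_le_pow_iff_right (Fintype.one_lt_card (α := F))).1 hcard
  rw [mul_comm, ← Finset.sum_coe_sort U.1]
  exact h1

lemma le_of_mem_achievableRates {F : Type*} [Fintype F] [Nontrivial F] {C r N : ℕ}
    (hrC : r ≤ C) (hN : 0 < N) {M R : ℝ} (hR : R ∈ achievableRates F C r N M) :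
    1 - (r : ℝ) * M / (N : ℝ) ≤ R := by
  obtain ⟨f, hf, S, hc, hs, hS⟩ := hR
  obtain ⟨U, -, hU⟩ := Finset.exists_subset_card_eq
    (s := (Finset.univ : Finset (Fin C))) (n := r) (by simpa using hrC)
  have h := S.cutset_bound hS ⟨U, hU⟩
  have h' : (N : ℝ) * f ≤ ∑ c ∈ U, (S.cacheLen c : ℝ) +
      ∑ n : Fin N, (S.sendLen (fun _ => n) : ℝ) := by exact_mod_cast h
  have h1 : ∑ c ∈ U, (S.cacheLen c : ℝ) ≤ r * (M * f) := by
    have := Finset.sum_le_card_nsmul U (fun c => (S.cacheLen c : ℝ)) (M * f) fun c _ => hc c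
    rwa [hU, nsmul_eq_mul] at this
  have h2 : ∑ n : Fin N, (S.sendLen (fun _ => n) : ℝ) ≤ N * (R * f) := by
    have := Finset.sum_le_card_nsmul Finset.univ
      (fun n : Fin N => (S.sendLen (fun _ => n) : ℝ)) (R * f) fun n _ => hs _
    simpa using this
  have hf' : (0 : ℝ) < f := by exact_mod_cast hf
  have hN' : (0 : ℝ) < N := by exact_mod_cast hN
  have h3 : (N : ℝ) ≤ r * M + N * R := by
    refine le_of_mul_le_mul_right ?_ hf'
    linarith
  rw [sub_le_iff_le_add, ← sub_le_iff_le_add', le_div_iff₀ hN']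
  linarith

end MACC
-- Pieces of a file and the symmetric matching
namespace MACC

/-- `c` is the first element of `S` in the order given by `σ`. -/
def IsFirst {n : ℕ} (σ : Equiv.Perm (Fin n)) (S : Finset (Fin n)) (c : Fin n) : Prop :=
  c ∈ S ∧ ∀ x ∈ S, σ c ≤ σ x

lemma IsFirst.unique {n : ℕ} {σ : Equiv.Perm (Fin n)} {S : Finset (Fin n)} {c c' : Fin n}
    (h : IsFirst σ S c) (h' : IsFirst σ S c') : c = c' :=
  σ.injective (le_antisymm (h.2 c' h'.1) (h'.2 c h.1))

lemma exists_isFirst {n : ℕ} (σ : Equiv.Perm (Fin n)) {S : Finset (Fin n)} (hS : S.Nonempty) :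
    ∃ c, IsFirst σ S c :=
  S.exists_min_image σ hS

/-- The pieces a file is split into: `a` pieces for each user and each order of the caches, and
`b` further pieces for each order of the caches. -/
abbrev Piece (C r a b : ℕ) : Type :=
  (User C r × Equiv.Perm (Fin C) × Fin a) ⊕ (Equiv.Perm (Fin C) × Fin b)

namespace Piece

variable {C r a b : ℕ}

/-- The caches whose content does not involve a given piece. -/
def mask : Piece C r a b → Finset (Fin C) :=
  Sum.elim (fun p => p.1.1) (fun _ => ∅)

/-- The order of the caches that labels a piece. -/
def order : Piece C r a b → Equiv.Perm (Fin C) :=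
  Sum.elim (fun p => p.2.1) (fun p => p.1)

/-- The action on the pieces of a permutation of the caches. -/
def relabel (τ : Equiv.Perm (Fin C)) : Equiv.Perm (Piece C r a b) :=
  Equiv.sumCongr
    (Equiv.prodCongr (Equiv.subtypeEquiv τ.finsetCongr (by simp))
      (Equiv.prodCongr (Equiv.mulRight τ⁻¹) (Equiv.refl _)))
    (Equiv.prodCongr (Equiv.mulRight τ⁻¹) (Equiv.refl _))

lemma mem_mask_relabel (τ : Equiv.Perm (Fin C)) (p : Piece C r a b) (x : Fin C) :
    τ x ∈ (relabel τ p).mask ↔ x ∈ p.mask := by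
  rcases p with p | p <;> simp [relabel, mask]

lemma order_relabel (τ : Equiv.Perm (Fin C)) (p : Piece C r a b) (x : Fin C) :
    (relabel τ p).order (τ x) = p.order x := by
  rcases p with p | p <;> simp [relabel, order]

open Classical in
/-- The pieces assigned to `c` among the caches in `U`. -/
noncomputable def fiber (U : Finset (Fin C)) (c : Fin C) : Finset (Piece C r a b) :=
  Finset.univ.filter fun p => IsFirst p.order (U \ p.mask) c

lemma mem_fiber {U : Finset (Fin C)} {c : Fin C} {p : Piece C r a b} :
    p ∈ fiber U c ↔ IsFirst p.order (U \ p.mask) c := by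
  simp [fiber]

lemma isFirst_relabel_iff {U : Finset (Fin C)} {τ : Equiv.Perm (Fin C)}
    (hτ : ∀ x, τ x ∈ U ↔ x ∈ U) (c : Fin C) (p : Piece C r a b) :
    IsFirst (relabel τ p).order (U \ (relabel τ p).mask) (τ c) ↔
      IsFirst p.order (U \ p.mask) c := by
  unfold IsFirst
  rw [← τ.forall_congr_right]
  simp only [Finset.mem_sdiff, mem_mask_relabel, hτ, order_relabel]

/-- Swapping `c` and `c'` preserves `U`, and the induced relabelling of masks and orders carries one
fiber onto the other. This symmetry is the reason for labelling pieces by all orders of the caches.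
-/
lemma card_fiber_eq {U : Finset (Fin C)} {c c' : Fin C} (hc : c ∈ U) (hc' : c' ∈ U) :
    (fiber U c : Finset (Piece C r a b)).card = (fiber U c' : Finset (Piece C r a b)).card := by
  have hτ : ∀ x, Equiv.swap c c' x ∈ U ↔ x ∈ U := by
    intro x
    rcases em (x = c) with h | h
    · subst h; simp [hc, hc']
    · by_cases h' : x = c'
      · subst h'; simp [hc, hc']
      · rw [Equiv.swap_apply_of_ne_of_ne h h']
  refine Finset.card_equiv (relabel (Equiv.swap c c')) fun p => ?_
  rw [mem_fiber, mem_fiber, ← isFirst_relabel_iff hτ c p, Equiv.swap_apply_left]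

/-- A mask has `r` elements or none, so it contains `U` only if it equals `U`. -/
lemma sdiff_mask_nonempty {U : User C r} {p : Piece C r a b} :
    (U.1 \ p.mask).Nonempty ↔ p.mask ≠ U.1 := by
  rw [Finset.sdiff_nonempty]
  refine not_congr ?_
  rcases p with p | p
  · refine ⟨fun h => (Finset.eq_of_subset_of_card_le h ?_).symm, fun h => h.ge⟩
    simp [mask, p.1.2, U.2]
  · simp only [mask, Sum.elim_inr, Finset.subset_empty]
    exact eq_comm

lemma card_mask_eq (U : User C r) (hr : 0 < r) :
    (Finset.univ.filter fun p : Piece C r a b => p.mask = U.1).card = C.factorial * a := by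
  have h : (Finset.univ.filter fun p : Piece C r a b => p.mask = U.1) =
      Finset.univ.image fun x : Equiv.Perm (Fin C) × Fin a => Sum.inl (U, x) := by
    ext p
    rw [Finset.mem_filter, Finset.mem_image]
    constructor
    · rintro ⟨-, hp⟩
      rcases p with ⟨V, x⟩ | p
      · obtain rfl : V = U := Subtype.ext hp
        exact ⟨x, Finset.mem_univ _, rfl⟩
      · have h0 : (∅ : Finset (Fin C)) = U.1 := hp
        have h1 := U.2
        rw [← h0, Finset.card_empty] at h1
        omega
    · rintro ⟨x, -, rfl⟩
      exact ⟨Finset.mem_univ _, rfl⟩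
  rw [h, Finset.card_image_of_injective _ fun x y hxy => (Prod.mk.inj (Sum.inl.inj hxy)).2]
  simp [Fintype.card_perm]

lemma card_piece : Fintype.card (Piece C r a b) = C.factorial * (C.choose r * a + b) := by
  simp only [Fintype.card_sum, Fintype.card_prod, Fintype.card_perm, Fintype.card_fin,
    Fintype.card_finset_len]
  ring

lemma biUnion_fiber (U : User C r) :
    U.1.biUnion (fiber (a := a) (b := b) (r := r) U.1) =
      Finset.univ.filter fun p : Piece C r a b => ¬ p.mask = U.1 := by
  ext p
  simp only [Finset.mem_biUnion, mem_fiber, Finset.mem_filter, Finset.mem_univ, true_and]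
  rw [← ne_eq, ← sdiff_mask_nonempty]
  constructor
  · rintro ⟨c, -, h⟩
    exact ⟨c, h.1⟩
  · intro h
    obtain ⟨c, hc⟩ := exists_isFirst p.order h
    exact ⟨c, (Finset.mem_sdiff.1 hc.1).1, hc⟩

/-- Each piece of mask different from `U` has exactly one first unmasked cache in `U`, so the `r`
equal fibers partition these pieces. -/
lemma mul_card_fiber (U : User C r) (hr : 0 < r) {c : Fin C} (hc : c ∈ U.1) :
    r * (fiber U.1 c : Finset (Piece C r a b)).card + C.factorial * a =
      C.factorial * (C.choose r * a + b) := by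
  have h1 : (U.1.biUnion (fiber (a := a) (b := b) (r := r) U.1)).card =
      r * (fiber U.1 c : Finset (Piece C r a b)).card := by
    rw [Finset.card_biUnion, Finset.sum_const_nat fun x hx => card_fiber_eq hx hc, U.2]
    intro x _ y _ hxy
    refine Finset.disjoint_left.2 fun p hp hq => hxy ?_
    exact (mem_fiber.1 hp).unique (mem_fiber.1 hq)
  rw [← h1, biUnion_fiber U, ← card_mask_eq (b := b) U hr, add_comm,
    Finset.card_filter_add_card_filter_not, Finset.card_univ, card_piece]

/-- The pieces that user `U` does not receive from the transmission can be split evenly among its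
caches, each cache being assigned pieces it does not mask. -/
lemma exists_matching (U : User C r) (hr : 0 < r) {m : ℕ}
    (hm : r * m + C.factorial * a = C.factorial * (C.choose r * a + b)) :
    ∃ φ : {c // c ∈ U.1} × Fin m → Piece C r a b, Function.Injective φ ∧
      (∀ x, x.1.1 ∉ (φ x).mask) ∧ ∀ p : Piece C r a b, p.mask ≠ U.1 → p ∈ Set.range φ := by
  have hcard (c : {c // c ∈ U.1}) : (fiber U.1 c.1 : Finset (Piece C r a b)).card = m := by
    have := mul_card_fiber (a := a) (b := b) U hr c.2
    exact Nat.eq_of_mul_eq_mul_left hr (by omega)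
  let ψ (c : {c // c ∈ U.1}) := ((fiber U.1 c.1 : Finset (Piece C r a b)).equivFinOfCardEq
    (hcard c)).symm
  have hψ (x : {c // c ∈ U.1} × Fin m) := mem_fiber.1 (ψ x.1 x.2).2
  refine ⟨fun x => (ψ x.1 x.2).1, ?_, fun x => (Finset.mem_sdiff.1 (hψ x).1).2, ?_⟩
  · rintro ⟨c, j⟩ ⟨c', j'⟩ h
    have h1 := hψ (c, j)
    have h2 := hψ (c', j')
    simp only at h h1 h2
    rw [← h] at h2
    obtain rfl : c = c' := Subtype.ext (h1.unique h2)
    rw [(ψ c).injective (Subtype.ext h)]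
  · intro p hp
    obtain ⟨c, hc⟩ := exists_isFirst p.order (sdiff_mask_nonempty.2 hp)
    have hcU := (Finset.mem_sdiff.1 hc.1).1
    exact ⟨(⟨c, hcU⟩, (ψ ⟨c, hcU⟩).symm ⟨p, mem_fiber.2 hc⟩), by simp⟩

end Piece

end MACC
-- Generic coefficients over a finite extension
namespace MACC

/-- A nonzero polynomial over a field does not vanish identically on a suitable finite
extension. -/
lemma exists_finite_extension_aeval_ne_zero {F : Type*} [Field F] {σ : Type*} [Finite σ]
    {P : MvPolynomial σ F} (hP : P ≠ 0) :
    ∃ (L : IntermediateField F (AlgebraicClosure F)) (_ : FiniteDimensional F L) (x : σ → L),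
      MvPolynomial.aeval x P ≠ 0 := by
  have hP' : P.map (algebraMap F (AlgebraicClosure F)) ≠ 0 := fun h =>
    hP (MvPolynomial.map_injective _ (algebraMap F (AlgebraicClosure F)).injective
      (h.trans (map_zero _).symm))
  obtain ⟨y, hy⟩ : ∃ y, MvPolynomial.eval y (P.map (algebraMap F (AlgebraicClosure F))) ≠ 0 := by
    by_contra! h
    -- The algebraic closure is infinite, so a polynomial vanishing at all its points is zero.
    exact hP' (MvPolynomial.funext fun y => by rw [h y, map_zero])
  let L := IntermediateField.adjoin F (Set.range y)
  have hL : FiniteDimensional F L :=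
    IntermediateField.finiteDimensional_adjoin fun z _ => Algebra.IsIntegral.isIntegral z
  let x : σ → L := fun i => ⟨y i, IntermediateField.subset_adjoin _ _ ⟨i, rfl⟩⟩
  refine ⟨L, hL, x, fun h => hy ?_⟩
  have h1 := congrArg (algebraMap L (AlgebraicClosure F)) h
  rw [← MvPolynomial.aeval_algebraMap_apply, map_zero, MvPolynomial.aeval_def] at h1
  rw [MvPolynomial.eval_map]
  exact h1

/-- Coefficients over a finite extension for the placement: the content of cache `c` involves no
piece that `c` masks, and the caches of any user determine all the pieces of mask different from
that user. -/
lemma exists_placement_coefficients (F : Type*) [Field F] {C r a b m : ℕ} (hr : 0 < r)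
    (hm : r * m + C.factorial * a = C.factorial * (C.choose r * a + b)) :
    ∃ (L : IntermediateField F (AlgebraicClosure F)) (_ : FiniteDimensional F L)
      (A : Fin C → Fin m → Piece C r a b → L),
      (∀ c j p, c ∈ p.mask → A c j p = 0) ∧
      ∀ (U : User C r) (v : Piece C r a b → L),
        (∀ c ∈ U.1, ∀ j, ∑ p, A c j p * v p = 0) → ∀ p, p.mask ≠ U.1 → v p = 0 := by
  classical
  choose φ hinj hmask hrange using fun U : User C r => Piece.exists_matching (b := b) U hr hm
  let B (c : Fin C) (j : Fin m) (p : Piece C r a b) :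
      MvPolynomial (Fin C × Fin m × Piece C r a b) F :=
    if c ∈ p.mask then 0 else MvPolynomial.X (c, j, p)
  let Q (U : User C r) : Matrix ({c // c ∈ U.1} × Fin m) ({c // c ∈ U.1} × Fin m)
      (MvPolynomial (Fin C × Fin m × Piece C r a b) F) :=
    Matrix.of fun x y => B x.1.1 x.2 (φ U y)
  have hQ (U : User C r) : (Q U).det ≠ 0 := by
    intro h
    -- The indicator of the matching specializes the generic matrix to the identity.
    let z : Fin C × Fin m × Piece C r a b → F := fun q =>
      if ∃ x : {c // c ∈ U.1} × Fin m, x.1.1 = q.1 ∧ x.2 = q.2.1 ∧ φ U x = q.2.2 then 1 else 0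
    have h1 := congrArg (MvPolynomial.eval z) h
    rw [RingHom.map_det, map_zero] at h1
    have h2 : (MvPolynomial.eval z).mapMatrix (Q U) = 1 := by
      ext x y
      have hz : z (x.1.1, x.2, φ U y) = if x = y then 1 else 0 := by
        refine if_congr ?_ rfl rfl
        constructor
        · rintro ⟨w, hw1, hw2, hw3⟩
          rw [← hinj U hw3]
          exact (Prod.ext (Subtype.ext hw1) hw2).symm
        · rintro rfl
          exact ⟨x, rfl, rfl, rfl⟩
      simp only [RingHom.mapMatrix_apply, Matrix.map_apply, Q, Matrix.of_apply, B,
        Matrix.one_apply]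
      split_ifs with h3 h4 h4
      · subst h4; exact absurd h3 (hmask U x)
      · simp
      · rw [MvPolynomial.eval_X, hz, if_pos h4]
      · rw [MvPolynomial.eval_X, hz, if_neg h4]
    rw [h2, Matrix.det_one] at h1
    exact one_ne_zero h1
  -- The product of the determinants gives one point that works for all users at once.
  obtain ⟨L, hL, x, hx⟩ := exists_finite_extension_aeval_ne_zero
    (Finset.prod_ne_zero_iff.2 fun U _ => hQ U : ∏ U, (Q U).det ≠ 0)
  rw [map_prod, Finset.prod_ne_zero_iff] at hx
  refine ⟨L, hL, fun c j p => if c ∈ p.mask then 0 else x (c, j, p),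
    fun c j p h => if_pos h, fun U v hv => ?_⟩
  have hdet : ((MvPolynomial.aeval x).mapMatrix (Q U)).det ≠ 0 := by
    rw [← AlgHom.map_det]
    exact hx U (Finset.mem_univ U)
  have hzero : (fun y => v (φ U y)) = 0 := by
    refine Matrix.eq_zero_of_mulVec_eq_zero hdet (funext fun y => ?_)
    rw [Pi.zero_apply, ← hv y.1.1 y.1.2 y.2]
    -- Pieces outside the range of the matching have mask `U`, hence coefficient zero in every cache
    -- of `U`.
    refine Fintype.sum_of_injective (φ U) (hinj U) _ _ ?_ ?_
    · intro p hp
      have hpU : p.mask = U.1 := by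
        by_contra hne
        exact hp (hrange U p hne)
      have hy : y.1.1 ∈ p.mask := by rw [hpU]; exact y.1.2
      simp only [if_pos hy, zero_mul]
    · intro w
      simp only [AlgHom.mapMatrix_apply, Matrix.map_apply, Q, Matrix.of_apply, B]
      split_ifs <;> simp
  intro p hp
  obtain ⟨y, rfl⟩ := hrange U p hp
  exact congrFun hzero y

end MACC
-- The coded scheme and its rates
namespace MACC

/-- Encodings may be arbitrary functions, so a bijection obtained by counting is enough; each symbol
of `L` costs `e` symbols of `F`. -/
lemma nonempty_equiv_symbols (F : Type*) [Fintype F] {L ι : Type*} [Fintype L] [Fintype ι]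
    {e k : ℕ} (hL : Fintype.card L = Fintype.card F ^ e) (hk : Fintype.card ι * e = k) :
    Nonempty ((ι → L) ≃ (Fin k → F)) := by
  classical
  rw [← Fintype.card_eq]
  simp only [Fintype.card_pi, Finset.prod_const, Finset.card_univ, Fintype.card_fin, hL]
  rw [← pow_mul, ← hk, mul_comm]

/-- The rate `a / t`, where `t = (C.choose r) * a + b`, is achieved by a placement of `m` coded
symbols for each file and each cache, when a file has `C! * t` symbols. -/
lemma exists_scheme (F : Type*) [Field F] [Fintype F] {C r a b m : ℕ} (N : ℕ) (hr : 0 < r)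
    (hm : r * m + C.factorial * a = C.factorial * (C.choose r * a + b)) :
    ∃ e : ℕ, 0 < e ∧ ∃ S : Scheme F C r N (C.factorial * (C.choose r * a + b) * e),
      (∀ c, S.cacheLen c = N * m * e) ∧ (∀ d, S.sendLen d = C.factorial * a * e) ∧
        S.Decodable := by
  classical
  obtain ⟨L, hL, A, hA, hAU⟩ := exists_placement_coefficients F (C := C) (a := a) (b := b) hr hm
  have : Finite L := Module.finite_of_finite F
  have : Fintype L := Fintype.ofFinite L
  have hcard : Fintype.card L = Fintype.card F ^ Module.finrank F L := Module.card_eq_pow_finrank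
  set e := Module.finrank F L with he
  obtain ⟨file⟩ := nonempty_equiv_symbols F (ι := Piece C r a b) hcard
    (k := C.factorial * (C.choose r * a + b) * e) (by rw [Piece.card_piece])
  obtain ⟨content⟩ := nonempty_equiv_symbols F (ι := Fin N × Fin m) hcard
    (k := N * m * e) (by simp)
  obtain ⟨signal⟩ := nonempty_equiv_symbols F (ι := Equiv.Perm (Fin C) × Fin a) hcard
    (k := C.factorial * a * e) (by simp [Fintype.card_perm])
  let S : Scheme F C r N (C.factorial * (C.choose r * a + b) * e) :=
    { cacheLen := fun _ => N * m * e
      cache := fun c W => content fun x => ∑ p, A c x.2 p * file.symm (W x.1) p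
      sendLen := fun _ => C.factorial * a * e
      send := fun d W => signal fun x => ∑ U, file.symm (W (d U)) (Sum.inl (U, x)) }
  refine ⟨e, Module.finrank_pos, S, fun _ => rfl, fun _ => rfl, ?_⟩
  rw [Scheme.decodable_iff]
  intro d U W W' hcache hsend
  have hknown (n : Fin N) (p : Piece C r a b) (hp : p.mask ≠ U.1) :
      file.symm (W n) p = file.symm (W' n) p := by
    rw [← sub_eq_zero]
    refine hAU U (fun p => file.symm (W n) p - file.symm (W' n) p) (fun c hc j => ?_) p hp
    have h := congrFun (content.injective (hcache c hc)) (n, j)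
    simp only [mul_sub, Finset.sum_sub_distrib]
    exact sub_eq_zero.2 h
  refine file.symm.injective (funext fun p => ?_)
  by_cases hp : p.mask = U.1
  · rcases p with ⟨V, x⟩ | p
    · obtain rfl : V = U := Subtype.ext hp
      have h := congrFun (signal.injective hsend) x
      -- The terms of the other users have masks different from `V`, so they are already known and
      -- cancel.
      rw [← Finset.add_sum_erase _ _ (Finset.mem_univ V),
        ← Finset.add_sum_erase Finset.univ (fun U => file.symm (W' (d U)) (Sum.inl (U, x)))
          (Finset.mem_univ V)] at h
      rw [Finset.sum_congr rfl fun V' hV' => hknown (d V') (Sum.inl (V', x)) fun h' =>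
        Finset.ne_of_mem_erase hV' (Subtype.ext h')] at h
      exact add_right_cancel h
    · have h0 : (∅ : Finset (Fin C)) = U.1 := hp
      have h1 := U.2
      rw [← h0, Finset.card_empty] at h1
      omega
  · exact hknown _ p hp

lemma mem_achievableRates_rational (F : Type*) [Field F] [Fintype F] {C r N : ℕ} (hr : 0 < r)
    (hrC : r < C) {M : ℝ} {q : ℚ} (hq : 0 ≤ q) (hqK : (C.choose r : ℚ) * q ≤ 1)
    (hM : (N : ℝ) * (1 - q) ≤ r * M) : (q : ℝ) ∈ achievableRates F C r N M := by
  obtain ⟨k, hk⟩ : r ∣ C.factorial := Nat.dvd_factorial hr hrC.le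
  obtain ⟨a, ha⟩ := Int.eq_ofNat_of_zero_le (Rat.num_nonneg.2 hq)
  have hden : (0 : ℚ) < q.den := by exact_mod_cast q.den_pos
  have hqa : q * q.den = a := by rw [Rat.mul_den_eq_num, ha]; rfl
  have hle : C.choose r * a ≤ q.den := by
    have : (C.choose r : ℚ) * a ≤ q.den := by
      rw [← hqa]; nlinarith
    exact_mod_cast this
  obtain ⟨b, hb⟩ := Nat.exists_eq_add_of_le hle
  have hK : 0 < C.choose r := Nat.choose_pos hrC.le
  have hal : a ≤ q.den := (Nat.le_mul_of_pos_left a hK).trans hle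
  obtain ⟨s, hs⟩ := Nat.exists_eq_add_of_le hal
  -- With `C! = r * k` and `q.den = a + s`, the choice `m = k * s` makes the number of equations
  -- match.
  obtain ⟨e, he, S, hc, hd, hS⟩ := exists_scheme F (C := C) (a := a) (b := b) (m := k * s) N hr
    (by rw [← hb, hs, hk]; ring)
  have hqa' : (q : ℝ) * q.den = a := by exact_mod_cast hqa
  have hs' : (q.den : ℝ) = a + s := by exact_mod_cast hs
  have hk' : (C.factorial : ℝ) = r * k := by exact_mod_cast hk
  have hr' : (0 : ℝ) < r := by exact_mod_cast hr
  refine ⟨_, ?_, S, fun c => ?_, fun d => ?_, hS⟩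
  · rw [← hb]; have := q.den_pos; have := C.factorial_pos; positivity
  · rw [hc, ← hb]
    push_cast
    have h1 : (N : ℝ) * s ≤ r * M * q.den := by
      have : (s : ℝ) = (1 - q) * q.den := by linarith
      rw [this, ← mul_assoc]
      gcongr
    calc (N : ℝ) * (k * s) * e = N * s * (k * e) := by ring
      _ ≤ r * M * q.den * (k * e) := by gcongr
      _ = M * (C.factorial * q.den * e) := by rw [hk']; ring
  · rw [hd, ← hb]
    push_cast
    rw [← hqa']
    exact le_of_eq (by ring)

end MACC

theorem theorem4 (F : Type*) [Field F] [Fintype F] (C r N : ℕ) (hr : 0 < r) (hrC : r < C)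
    (hN : 0 < N) (M : ℝ)
    (hM : ((C.choose r : ℝ) - 1) / ((r : ℝ) * (C.choose r : ℝ)) ≤ M / (N : ℝ))
    (hM' : M / (N : ℝ) ≤ 1 / (r : ℝ)) :
    IsGLB (MACC.achievableRates F C r N M) (1 - (r : ℝ) * M / (N : ℝ)) ∧
      MACC.optimalRate F C r N M = 1 - (r : ℝ) * M / (N : ℝ) := by
  have hr' : (0 : ℝ) < r := by exact_mod_cast hr
  have hN' : (0 : ℝ) < N := by exact_mod_cast hN
  have hK : (0 : ℝ) < C.choose r := by exact_mod_cast Nat.choose_pos hrC.le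
  set ρ : ℝ := 1 - (r : ℝ) * M / (N : ℝ) with hρ
  have hNρ : (N : ℝ) * (1 - ρ) = r * M := by rw [hρ]; field_simp; ring
  have hρ0 : 0 ≤ ρ := by
    rw [div_le_div_iff₀ hN' hr'] at hM'
    rw [hρ, sub_nonneg, div_le_one hN']
    linarith
  have hρK : ρ ≤ 1 / C.choose r := by
    rw [div_le_div_iff₀ (by positivity) hN'] at hM
    rw [le_div_iff₀ hK]
    refine le_of_mul_le_mul_left ?_ hN'
    nlinarith
  have hach (q : ℚ) (h1 : ρ ≤ q) (h2 : (q : ℝ) ≤ 1 / C.choose r) :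
      (q : ℝ) ∈ MACC.achievableRates F C r N M := by
    refine MACC.mem_achievableRates_rational F hr hrC ?_ ?_ ?_
    · exact_mod_cast hρ0.trans h1
    · rw [le_div_iff₀ hK] at h2
      rw [mul_comm]
      exact_mod_cast h2
    · rw [← hNρ]
      gcongr
  have hend : ((1 / C.choose r : ℚ) : ℝ) ∈ MACC.achievableRates F C r N M :=
    hach _ (by push_cast; exact hρK) (by push_cast; exact le_rfl)
  have hglb : IsGLB (MACC.achievableRates F C r N M) ρ := by
    refine ⟨fun R hR => MACC.le_of_mem_achievableRates hrC.le hN hR, fun x hx => ?_⟩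
    -- At the endpoint `1 / K` the rate is itself rational and achieved; below it, achievable
    -- rationals approach `ρ` from above.
    rcases hρK.eq_or_lt with h | h
    · rw [h]
      have := hx hend
      push_cast at this
      exact this
    · refine le_of_forall_gt_imp_ge_of_dense fun y hy => ?_
      obtain ⟨q, hq1, hq2⟩ := exists_rat_btwn (lt_min hy h)
      exact (hx (hach q hq1.le (hq2.le.trans (min_le_right _ _)))).trans
        (hq2.le.trans (min_le_left _ _))
  exact ⟨hglb, hglb.csInf_eq ⟨_, hend⟩⟩
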